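/- Let $n\ge 2$, let $S_n$ be the $n\times n$ complex matrix with ones on the subdiagonal and zeros elsewhere (the nilpotent shift), and let $1\le k\le n$. For an $n\times n$ complex matrix $T$, let $$\Lambda_k(T)=\{\lambda\in\mathbb C : PTP=\lambda P \text{ for some orthogonal projection } P \text{ of rank } k\}$$ be its rank-$k$ numerical range, and let $[x]$ denote the integer part of $x$. If $k\le\left[\frac{n+1}{2}\right]$, then $$\Lambda_k(S_n)=\left\{z\in\mathbb C : |z|\le\cos\frac{k\pi}{n+1}\right\},$$ and if $k>\left[\frac{n+1}{2}\right]$, then $\Lambda_k(S_n)=\emptyset$. -/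

import Mathlib

/-- The rank-`k` numerical range `Λ_k(T)` of a complex `n × n` matrix `T`: all `μ` with
`P T P = μ P` for some orthogonal projection `P` (that is, `P * P = P` and `Pᴴ = P`) of rank `k`. -/
def higherRankNumericalRange {n : ℕ} (k : ℕ) (T : Matrix (Fin n) (Fin n) ℂ) : Set ℂ :=
  {μ : ℂ | ∃ P : Matrix (Fin n) (Fin n) ℂ, IsStarProjection P ∧ P.rank = k ∧ P * T * P = μ • P}

/-- The `n`-dimensional shift: the `n × n` matrix with ones on the subdiagonal and zeros
elsewhere. -/
def shiftMatrix (n : ℕ) : Matrix (Fin n) (Fin n) ℂ :=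
  Matrix.of fun i j => if (i : ℕ) = (j : ℕ) + 1 then 1 else 0

open Matrix

/-! Everything rests on the recurrence sin((m+1)φ) + sin((m-1)φ) = 2 cos φ sin(mφ), which turns sine
vectors into solutions of pencils in S and Sᴴ. Upper bound: rotating z to |z| by a phase u, the
Hermitian matrix ūSᴴ + uS has eigenvalues 2cos(jπ/(n+1)). The span of the eigenvectors with j ≥ k
has dimension n+1-k, so it meets the rank-k range of P, and a common vector gives |z| ≤
cos(kπ/(n+1)). Emptiness follows once this cosine is negative. Lower bound: it suffices to find k
independent vectors on which the form of M = S - z vanishes. Solutions of Mᴴx = μMx with distinct μ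
supply them when z ≠ 0; for z = 0, alternate basis vectors do. -/

/-! ### Sine vectors under the shift and its adjoint -/

theorem shiftMatrix_mulVec {n : ℕ} (f : ℕ → ℂ) (h0 : f 0 = 0) (i : Fin n) :
    (shiftMatrix n *ᵥ fun l : Fin n => f (l + 1)) i = f i := by
  simp only [mulVec, dotProduct, shiftMatrix, of_apply, ite_mul, one_mul, zero_mul]
  rcases Nat.eq_zero_or_pos (i : ℕ) with hi | hi
  · rw [hi, h0]
    exact Finset.sum_eq_zero fun l _ => if_neg (by omega)
  · rw [Finset.sum_eq_single (⟨i - 1, by omega⟩ : Fin n)]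
    · rw [if_pos (by simp only; omega)]
      congr 1
      simp only
      omega
    · intro l _ hl
      exact if_neg fun h => hl (Fin.ext (by simp only; omega))
    · simp

theorem shiftMatrix_conjTranspose_mulVec {n : ℕ} (f : ℕ → ℂ) (hn : f (n + 1) = 0) (i : Fin n) :
    ((shiftMatrix n)ᴴ *ᵥ fun l : Fin n => f (l + 1)) i = f (i + 2) := by
  simp only [mulVec, dotProduct, shiftMatrix, of_apply, conjTranspose_apply, apply_ite star,
    star_one, star_zero, ite_mul, one_mul, zero_mul]
  by_cases hi : (i : ℕ) + 1 = n
  · rw [show (i : ℕ) + 2 = n + 1 by omega, hn]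
    exact Finset.sum_eq_zero fun l _ => if_neg (by omega)
  · rw [Finset.sum_eq_single (⟨i + 1, by omega⟩ : Fin n)]
    · rw [if_pos rfl]
    · intro l _ hl
      exact if_neg fun h => hl (Fin.ext h)
    · simp

/-- The vector `(z ^ m * sin (m * φ))` for `m = 1, …, n`. -/
noncomputable def sineVec (n : ℕ) (z : ℂ) (φ : ℝ) (i : Fin n) : ℂ :=
  z ^ ((i : ℕ) + 1) * ((Real.sin ((((i : ℕ) + 1 : ℕ) : ℝ) * φ) : ℝ) : ℂ)

theorem shiftMatrix_mulVec_sineVec (n : ℕ) (z : ℂ) (φ : ℝ) (i : Fin n) :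
    (shiftMatrix n *ᵥ sineVec n z φ) i
      = z ^ (i : ℕ) * ((Real.sin (((i : ℕ) : ℝ) * φ) : ℝ) : ℂ) :=
  shiftMatrix_mulVec (fun m => z ^ m * ((Real.sin ((m : ℝ) * φ) : ℝ) : ℂ)) (by simp) i

/-- The sine recurrence, weighted by powers of z. The boundary terms vanish at m = 0 automatically
and at m = n+1 by `hφ`. -/
theorem sineVec_pencil (n : ℕ) (z : ℂ) (φ : ℝ) (hφ : Real.sin (((n + 1 : ℕ) : ℝ) * φ) = 0) :
    (shiftMatrix n)ᴴ *ᵥ sineVec n z φ + z ^ 2 • (shiftMatrix n *ᵥ sineVec n z φ)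
      = (2 * z * (Real.cos φ : ℝ)) • sineVec n z φ := by
  ext i
  have h2 := shiftMatrix_conjTranspose_mulVec
    (fun m => z ^ m * ((Real.sin ((m : ℝ) * φ) : ℝ) : ℂ)) (by rw [hφ]; simp) i
  change ((shiftMatrix n)ᴴ *ᵥ sineVec n z φ) i = _ at h2
  rw [Pi.add_apply, h2, Pi.smul_apply, Pi.smul_apply, shiftMatrix_mulVec_sineVec]
  have key : Real.sin (((i : ℕ) + 2 : ℕ) * φ) + Real.sin ((i : ℕ) * φ)
      = 2 * Real.cos φ * Real.sin (((i : ℕ) + 1 : ℕ) * φ) := by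
    have e1 : (((i : ℕ) + 2 : ℕ) : ℝ) * φ = (((i : ℕ) + 1 : ℕ) : ℝ) * φ + φ := by push_cast; ring
    have e2 : ((i : ℕ) : ℝ) * φ = (((i : ℕ) + 1 : ℕ) : ℝ) * φ - φ := by push_cast; ring
    rw [e1, e2, Real.sin_add, Real.sin_sub]
    ring
  have key' := congrArg (fun t : ℝ => (t : ℂ)) key
  simp only [Complex.ofReal_add, Complex.ofReal_mul (2 * Real.cos φ),
    Complex.ofReal_mul 2, Complex.ofReal_ofNat] at key'
  simp only [sineVec, smul_eq_mul]
  linear_combination z ^ ((i : ℕ) + 2) * key'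

theorem sineVec_ne_zero {n : ℕ} (hn : 0 < n) {z : ℂ} (hz : z ≠ 0) {φ : ℝ}
    (hφ : Real.sin φ ≠ 0) : sineVec n z φ ≠ 0 := by
  intro h
  have := congrFun h ⟨0, hn⟩
  simp only [sineVec, zero_add, pow_one, Nat.cast_one, one_mul, Pi.zero_apply, mul_eq_zero,
    Complex.ofReal_eq_zero] at this
  exact this.elim hz hφ

theorem star_sineVec_dotProduct_shiftMatrix (n : ℕ) (z : ℂ) (φ : ℝ) :
    ∃ R : ℝ, star (sineVec n z φ) ⬝ᵥ (shiftMatrix n *ᵥ sineVec n z φ) = star z * (R : ℂ) := by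
  refine ⟨∑ i : Fin n, Complex.normSq z ^ (i : ℕ) *
    (Real.sin ((((i : ℕ) + 1 : ℕ) : ℝ) * φ) * Real.sin (((i : ℕ) : ℝ) * φ)), ?_⟩
  rw [dotProduct, Complex.ofReal_sum, Finset.mul_sum]
  refine Finset.sum_congr rfl fun i _ => ?_
  rw [shiftMatrix_mulVec_sineVec, Pi.star_apply, sineVec]
  simp only [Complex.ofReal_mul, Complex.ofReal_pow, Complex.normSq_eq_conj_mul_self, star_mul',
    star_pow, Complex.star_def, Complex.conj_ofReal]
  ring

/-! ### Solutions of Mᴴx = μMx -/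

theorem star_dotProduct_conjTranspose_mulVec {ι : Type*} [Fintype ι] (M : Matrix ι ι ℂ)
    (x y : ι → ℂ) : star x ⬝ᵥ (Mᴴ *ᵥ y) = star (star y ⬝ᵥ (M *ᵥ x)) := by
  rw [← star_dotProduct_star, star_star, star_mulVec, dotProduct_mulVec]

/-- Passing to the adjoint twice multiplies x*My by star μ * ν. -/
theorem star_dotProduct_eq_zero_of_pencil {ι : Type*} [Fintype ι] {M : Matrix ι ι ℂ}
    {x y : ι → ℂ} {μ ν : ℂ} (hx : Mᴴ *ᵥ x = μ • (M *ᵥ x)) (hy : Mᴴ *ᵥ y = ν • (M *ᵥ y))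
    (h : star μ * ν ≠ 1) : star x ⬝ᵥ (M *ᵥ y) = 0 := by
  have h1 := star_dotProduct_conjTranspose_mulVec M y x
  have h2 := star_dotProduct_conjTranspose_mulVec M x y
  rw [hx, dotProduct_smul, smul_eq_mul] at h1
  rw [hy, dotProduct_smul, smul_eq_mul] at h2
  have h3 : star x ⬝ᵥ (M *ᵥ y) = star μ * ν * (star x ⬝ᵥ (M *ᵥ y)) := by
    rw [mul_assoc, h2, ← star_mul', h1, star_star]
  by_contra h0
  exact h (mul_right_cancel₀ h0 (by rw [one_mul]; exact h3.symm))

/-- The x j are eigenvectors of M⁻¹Mᴴ for distinct eigenvalues. -/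
theorem linearIndependent_of_pencil {ι κ : Type*} [Fintype ι] [DecidableEq ι]
    {M : Matrix ι ι ℂ} (hM : IsUnit M.det) {x : κ → ι → ℂ} {μ : κ → ℂ}
    (hμ : Function.Injective μ) (hx : ∀ j, Mᴴ *ᵥ x j = μ j • (M *ᵥ x j))
    (h0 : ∀ j, x j ≠ 0) : LinearIndependent ℂ x := by
  refine Module.End.eigenvectors_linearIndependent' (Matrix.toLin' (M⁻¹ * Mᴴ)) μ hμ x fun j => ?_
  refine ⟨Module.End.mem_eigenspace_iff.2 ?_, h0 j⟩
  rw [toLin'_apply, ← mulVec_mulVec, hx, mulVec_smul, mulVec_mulVec, nonsing_inv_mul _ hM,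
    one_mulVec]

/-! ### From isotropic vectors to projections -/

-- The projection onto the column space of B is B(BᴴB)⁻¹Bᴴ.
open scoped ComplexOrder in
theorem mem_higherRankNumericalRange_of_compression {n k : ℕ} {T : Matrix (Fin n) (Fin n) ℂ}
    {μ : ℂ} (B : Matrix (Fin n) (Fin k) ℂ) (hB : Function.Injective B.mulVec)
    (h : Bᴴ * T * B = μ • (Bᴴ * B)) : μ ∈ higherRankNumericalRange k T := by
  have hG : (Bᴴ * B).PosDef := PosDef.conjTranspose_mul_self B hB
  have hdet : IsUnit (Bᴴ * B).det := (isUnit_iff_isUnit_det _).1 hG.isUnit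
  set G := Bᴴ * B with hGdef
  have hGi : G⁻¹ᴴ = G⁻¹ := by rw [conjTranspose_nonsing_inv, hG.isHermitian.eq]
  have hPB : B * G⁻¹ * Bᴴ * B = B := by
    rw [Matrix.mul_assoc, ← hGdef, Matrix.mul_assoc, nonsing_inv_mul _ hdet, Matrix.mul_one]
  refine ⟨B * G⁻¹ * Bᴴ, ⟨?_, ?_⟩, ?_, ?_⟩
  · change B * G⁻¹ * Bᴴ * (B * G⁻¹ * Bᴴ) = _
    rw [← Matrix.mul_assoc, ← Matrix.mul_assoc, hPB]
  · change (B * G⁻¹ * Bᴴ)ᴴ = _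
    rw [conjTranspose_mul, conjTranspose_mul, conjTranspose_conjTranspose, hGi, Matrix.mul_assoc]
  · have hrB : B.rank = k := by
      have := LinearIndependent.rank_matrix (M := Bᵀ) (mulVec_injective_iff.1 hB)
      rwa [rank_transpose, Fintype.card_fin] at this
    refine le_antisymm ?_ ?_
    · rw [Matrix.mul_assoc]
      exact (rank_mul_le_left _ _).trans hrB.le
    · calc k = (B * G⁻¹ * Bᴴ * B).rank := by rw [hPB, hrB]
        _ ≤ _ := rank_mul_le_left _ _
  · calc B * G⁻¹ * Bᴴ * T * (B * G⁻¹ * Bᴴ) = B * G⁻¹ * (Bᴴ * T * B) * G⁻¹ * Bᴴ := by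
          simp only [Matrix.mul_assoc]
      _ = μ • (B * (G⁻¹ * G) * G⁻¹ * Bᴴ) := by
          rw [h]; simp only [Matrix.mul_assoc, Matrix.mul_smul, Matrix.smul_mul]
      _ = _ := by rw [nonsing_inv_mul _ hdet, Matrix.mul_one]

theorem mem_higherRankNumericalRange_of_vectors {n k : ℕ} {T : Matrix (Fin n) (Fin n) ℂ}
    {μ : ℂ} {x : Fin k → Fin n → ℂ} (hx : LinearIndependent ℂ x)
    (h : ∀ i j, star (x i) ⬝ᵥ ((T - μ • 1) *ᵥ x j) = 0) :
    μ ∈ higherRankNumericalRange k T := by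
  refine mem_higherRankNumericalRange_of_compression (of x)ᵀ (mulVec_injective_iff.2 hx) ?_
  rw [← sub_eq_zero]
  have e : (of x)ᵀᴴ * T * (of x)ᵀ - μ • ((of x)ᵀᴴ * (of x)ᵀ)
      = (of x)ᵀᴴ * ((T - μ • 1) * (of x)ᵀ) := by
    rw [Matrix.sub_mul, Matrix.mul_sub, Matrix.smul_mul, Matrix.one_mul, Matrix.mul_smul,
      Matrix.mul_assoc]
  rw [e]
  ext i j
  exact h i j

/-! ### The disc is contained in the numerical range -/

theorem det_shiftMatrix_sub_smul (n : ℕ) (μ : ℂ) :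
    (shiftMatrix n - μ • 1).det = (-μ) ^ n := by
  rw [det_of_isLowerTriangular]
  · simp [shiftMatrix]
  · intro i j hij
    have hij' : (i : ℕ) < j := hij
    have : i ≠ j := fun h => by simp [h] at hij'
    simp only [shiftMatrix, Matrix.sub_apply, of_apply, Matrix.smul_apply, one_apply_ne this]
    rw [if_neg (by omega)]
    simp

/-- ν is the smaller root of rν² - 2cν + r; the two roots have product 1. -/
theorem exists_mul_one_add_sq_eq {r c : ℝ} (hr : 0 < r) (hc : r ≤ c) :
    ∃ ν : ℝ, 0 < ν ∧ ν ≤ 1 ∧ r * (1 + ν ^ 2) = 2 * ν * c := by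
  have hs : 0 ≤ c ^ 2 - r ^ 2 := by nlinarith
  have hsq := Real.sq_sqrt hs
  have hs0 := Real.sqrt_nonneg (c ^ 2 - r ^ 2)
  have hlt : Real.sqrt (c ^ 2 - r ^ 2) < c := by nlinarith
  have hge : c - r ≤ Real.sqrt (c ^ 2 - r ^ 2) := Real.le_sqrt_of_sq_le (by nlinarith)
  refine ⟨(c - Real.sqrt (c ^ 2 - r ^ 2)) / r, div_pos (by linarith) hr,
    (div_le_one hr).2 (by linarith), ?_⟩
  field_simp
  nlinarith

/-- Treated separately because S itself is singular. The shift sends even-indexed basis vectors to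
odd-indexed ones or to 0. -/
theorem zero_mem_higherRankNumericalRange_shiftMatrix {n k : ℕ} (hk : k ≤ (n + 1) / 2) :
    (0 : ℂ) ∈ higherRankNumericalRange k (shiftMatrix n) := by
  let e : Fin k → Fin n := fun j => ⟨2 * j, by omega⟩
  have he : Function.Injective e := fun i j h => by
    have : 2 * (i : ℕ) = 2 * j := congrArg Fin.val h
    exact Fin.ext (by omega)
  refine mem_higherRankNumericalRange_of_vectors
    (x := fun j => Pi.single (e j) (1 : ℂ)) ?_ fun i j => ?_
  · have := (Pi.basisFun ℂ (Fin n)).linearIndependent.comp e he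
    convert this using 1
    ext j : 1
    simp
  · have : ¬ (2 * (i : ℕ) = 2 * j + 1) := by omega
    simp [shiftMatrix, e, this]

theorem sin_nat_mul_pi_div (n j : ℕ) :
    Real.sin (((n + 1 : ℕ) : ℝ) * (j * Real.pi / (n + 1))) = 0 := by
  have : ((n + 1 : ℕ) : ℝ) * (j * Real.pi / (n + 1)) = j * Real.pi := by
    push_cast
    field_simp
  rw [this, Real.sin_nat_mul_pi]

theorem mul_pi_div_mem_Ioo {n j : ℕ} (hj : 1 ≤ j) (hjn : j ≤ n) :
    (j : ℝ) * Real.pi / (n + 1) ∈ Set.Ioo 0 Real.pi := by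
  have hj' : (1 : ℝ) ≤ j := by exact_mod_cast hj
  have hjn' : (j : ℝ) ≤ n := by exact_mod_cast hjn
  have hpi := Real.pi_pos
  refine ⟨by positivity, ?_⟩
  rw [div_lt_iff₀ (by positivity)]
  nlinarith

theorem cos_mul_pi_div_le {n i j : ℕ} (hij : i ≤ j) (hjn : j ≤ n) :
    Real.cos (j * Real.pi / (n + 1)) ≤ Real.cos (i * Real.pi / (n + 1)) := by
  rcases Nat.eq_zero_or_pos j with rfl | hj
  · rw [Nat.le_zero.1 hij]
  have hpi := Real.pi_pos
  refine Real.cos_le_cos_of_nonneg_of_le_pi (by positivity) (mul_pi_div_mem_Ioo hj hjn).2.le ?_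
  have : (i : ℝ) ≤ j := by exact_mod_cast hij
  gcongr

theorem eq_of_cos_mul_pi_div_eq {n i j : ℕ} (hi : 1 ≤ i) (hin : i ≤ n) (hj : 1 ≤ j)
    (hjn : j ≤ n) (h : Real.cos (i * Real.pi / (n + 1)) = Real.cos (j * Real.pi / (n + 1))) :
    i = j := by
  have := Real.injOn_cos (Set.Ioo_subset_Icc_self (mul_pi_div_mem_Ioo hi hin))
    (Set.Ioo_subset_Icc_self (mul_pi_div_mem_Ioo hj hjn)) h
  have hpi := Real.pi_pos
  field_simp at this
  exact_mod_cast this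

theorem exists_unit_mul_norm (z : ℂ) : ∃ u : ℂ, star u * u = 1 ∧ z = star u * (‖z‖ : ℂ) := by
  by_cases hz : z = 0
  · exact ⟨1, by simp, by simp [hz]⟩
  have hz' : (‖z‖ : ℂ) ≠ 0 := by simpa using hz
  have hc : star z * z = (‖z‖ : ℂ) ^ 2 := Complex.conj_mul' z
  have hr : star (‖z‖ : ℂ) = ‖z‖ := Complex.conj_ofReal _
  refine ⟨star z / ‖z‖, ?_, ?_⟩
  · rw [star_div₀, star_star, hr]
    field_simp
    linear_combination hc
  · rw [star_div₀, star_star, hr]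
    field_simp

theorem mem_higherRankNumericalRange_shiftMatrix {n k : ℕ} (hk : 1 ≤ k) (hkn : k ≤ n) {z : ℂ}
    (hz : z ≠ 0) (hzk : ‖z‖ ≤ Real.cos (k * Real.pi / (n + 1))) :
    z ∈ higherRankNumericalRange k (shiftMatrix n) := by
  obtain ⟨u, hu, hzu⟩ := exists_unit_mul_norm z
  have hr : 0 < ‖z‖ := norm_pos_iff.2 hz
  set r := ‖z‖
  set φ : Fin k → ℝ := fun j => ((j + 1 : ℕ) : ℝ) * Real.pi / (n + 1) with hφ
  have hc : ∀ j, r ≤ Real.cos (φ j) := fun j =>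
    hzk.trans (cos_mul_pi_div_le (by omega) hkn)
  choose ν hν0 hν1 hν using fun j => exists_mul_one_add_sq_eq hr (hc j)
  -- ν j determines cos (φ j) = r(1 + ν²)/(2ν), hence j.
  have hνinj : Function.Injective ν := by
    intro i j hij
    have h1 : 2 * ν j * Real.cos (φ i) = 2 * ν j * Real.cos (φ j) := by
      rw [← hν j, ← hij, hν i]
    have h2 := mul_left_cancel₀ (by have := hν0 j; positivity) h1
    have := eq_of_cos_mul_pi_div_eq (by omega) (by omega) (by omega) (by omega) h2
    exact Fin.ext (by omega)
  have hu0 : u ≠ 0 := by rintro rfl; simp at hu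
  set x : Fin k → Fin n → ℂ := fun j => sineVec n (ν j * u) (φ j) with hx
  have hνC : ∀ j, (r : ℂ) * (1 + (ν j : ℂ) ^ 2) = 2 * ν j * (Real.cos (φ j) : ℝ) := fun j => by
    exact_mod_cast congrArg (fun t : ℝ => (t : ℂ)) (hν j)
  have hzs : star z = u * r := by
    rw [hzu, star_mul', star_star]
    congr 1
    exact Complex.conj_ofReal _
  have hpen0 := fun j => sineVec_pencil n (ν j * u) (φ j) (sin_nat_mul_pi_div n (j + 1))
  have hpen : ∀ j, (shiftMatrix n - z • 1)ᴴ *ᵥ x j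
      = (-(ν j * u) ^ 2) • ((shiftMatrix n - z • 1) *ᵥ x j) := by
    intro j
    have h1 := hpen0 j
    -- The choice of ν j cancels exactly the multiple of x j left over when S is replaced by S - z
    -- in the pencil.
    have h2 : ((ν j : ℂ) * u) ^ 2 * z - 2 * (ν j * u) * (Real.cos (φ j) : ℝ) + star z = 0 := by
      rw [hzs]
      nth_rewrite 1 [hzu]
      linear_combination (ν j : ℂ) ^ 2 * u * r * hu + u * hνC j
    rw [conjTranspose_sub, conjTranspose_smul, conjTranspose_one, sub_mulVec, sub_mulVec,
      smul_mulVec, smul_mulVec, one_mulVec]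
    ext i
    have h3 := congrFun h1 i
    simp only [Pi.add_apply, Pi.sub_apply, Pi.smul_apply, smul_eq_mul, hx] at h3 ⊢
    linear_combination h3 - sineVec n (ν j * u) (φ j) i * h2
  have hμinj : Function.Injective fun j => -((ν j : ℂ) * u) ^ 2 := by
    intro i j h
    simp only [mul_pow, neg_inj] at h
    have h1 := mul_right_cancel₀ (pow_ne_zero 2 hu0) h
    have h2 : ν i ^ 2 = ν j ^ 2 := by exact_mod_cast h1
    exact hνinj ((pow_left_inj₀ (hν0 i).le (hν0 j).le two_ne_zero).1 h2)
  refine mem_higherRankNumericalRange_of_vectors (x := x) ?_ ?_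
  · refine linearIndependent_of_pencil (M := shiftMatrix n - z • 1) ?_ hμinj hpen fun j => ?_
    · rw [det_shiftMatrix_sub_smul]
      exact (pow_ne_zero _ (neg_ne_zero.2 hz)).isUnit
    · refine sineVec_ne_zero (by omega) (mul_ne_zero ?_ hu0) ?_
      · exact_mod_cast (hν0 j).ne'
      · have hm := mul_pi_div_mem_Ioo (n := n) (j := j + 1) (by omega) (by omega)
        exact (Real.sin_pos_of_pos_of_lt_pi hm.1 hm.2).ne'
  intro i j
  -- If ν i = 1 the pencil argument says nothing on the diagonal, so the diagonal is computed
  -- directly, using that x*Sx is a real multiple of the conjugate of ν i * u.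
  by_cases hij : i = j
  · subst hij
    obtain ⟨R, hR⟩ := star_sineVec_dotProduct_shiftMatrix n (ν i * u) (φ i)
    have h1 := congrArg (fun v => star (x i) ⬝ᵥ v) (hpen0 i)
    simp only [dotProduct_add, dotProduct_smul, star_dotProduct_conjTranspose_mulVec, hx, hR,
      smul_eq_mul] at h1
    rw [sub_mulVec, dotProduct_sub, smul_mulVec, one_mulVec, dotProduct_smul, hx, hR, smul_eq_mul]
    have hsν : star (ν i : ℂ) = ν i := Complex.conj_ofReal _
    have hsR : star (R : ℂ) = R := Complex.conj_ofReal _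
    simp only [star_mul', star_star, hsν, hsR] at h1 ⊢
    set N := star (sineVec n (ν i * u) (φ i)) ⬝ᵥ sineVec n (ν i * u) (φ i)
    have hνi : (ν i : ℂ) ≠ 0 := by exact_mod_cast (hν0 i).ne'
    have h1ν : (1 + (ν i : ℂ) ^ 2) ≠ 0 := by
      have : (1 + ν i ^ 2) ≠ 0 := by positivity
      exact_mod_cast this
    have h4 : (ν i : ℂ) * u * (1 + (ν i : ℂ) ^ 2) * (ν i * R - r * N) = 0 := by
      linear_combination (ν i : ℂ) * h1 - (ν i : ℂ) * u * N * hνC i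
        - (ν i : ℂ) ^ 4 * u * R * hu
    have h5 : (ν i : ℂ) * R - r * N = 0 :=
      (mul_eq_zero.1 h4).resolve_left (mul_ne_zero (mul_ne_zero hνi hu0) h1ν)
    rw [hzu]
    linear_combination star u * h5
  · refine star_dotProduct_eq_zero_of_pencil (hpen i) (hpen j) fun h => ?_
    have hsν : star (ν i : ℂ) = ν i := Complex.conj_ofReal _
    rw [star_neg, star_pow, star_mul', hsν] at h
    have h1 : ((ν i : ℂ) * ν j) ^ 2 = 1 := by
      linear_combination h - ((ν i : ℂ) * ν j) ^ 2 * (star u * u + 1) * hu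
    have h2 : (ν i * ν j) ^ 2 = 1 := by exact_mod_cast h1
    -- With both factors in (0, 1] this forces ν i = ν j = 1, against injectivity.
    have h3 : ν i * ν j = 1 :=
      (pow_eq_one_iff_of_nonneg (mul_nonneg (hν0 i).le (hν0 j).le) two_ne_zero).1 h2
    have h4 : ν i = 1 := le_antisymm (hν1 i) (by nlinarith [hν0 i, hν1 j])
    have h5 : ν j = 1 := by rw [h4, one_mul] at h3; exact h3
    exact hij (hνinj (h4.trans h5.symm))

/-! ### The numerical range is contained in the disc -/

open scoped ComplexOrder in
theorem norm_le_of_mem_higherRankNumericalRange_shiftMatrix {n k : ℕ} (hk : 1 ≤ k) (hkn : k ≤ n)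
    {z : ℂ} (hz : z ∈ higherRankNumericalRange k (shiftMatrix n)) :
    ‖z‖ ≤ Real.cos (k * Real.pi / (n + 1)) := by
  obtain ⟨P, ⟨hP1, hP2⟩, hrank, hP⟩ := hz
  have hP1 : P * P = P := hP1
  have hP2 : Pᴴ = P := hP2
  obtain ⟨u, hu, hzu⟩ := exists_unit_mul_norm z
  have hu0 : u ≠ 0 := by rintro rfl; simp at hu
  set S := shiftMatrix n with hS
  set φ : Fin (n + 1 - k) → ℝ := fun j => ((j + k : ℕ) : ℝ) * Real.pi / (n + 1) with hφ
  set y : Fin (n + 1 - k) → Fin n → ℂ := fun j => sineVec n u (φ j) with hy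
  set H : Matrix (Fin n) (Fin n) ℂ := star u • Sᴴ + u • S with hH
  have hHy : ∀ j, H *ᵥ y j = ((2 * Real.cos (φ j) : ℝ) : ℂ) • y j := by
    intro j
    have h1 := congrArg (fun v => star u • v)
      (sineVec_pencil n u (φ j) (sin_nat_mul_pi_div n (j + k)))
    rw [hH, add_mulVec, smul_mulVec, smul_mulVec]
    ext i
    have h3 := congrFun h1 i
    simp only [Pi.add_apply, Pi.smul_apply, smul_eq_mul, hy] at h3 ⊢
    push_cast at h3 ⊢
    linear_combination h3 + (2 * Complex.cos (φ j) * sineVec n u (φ j) i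
      - u * (S *ᵥ sineVec n u (φ j)) i) * hu
  have hHH : Hᴴ = H := by
    simp [hH, add_comm]
  have hcinj : Function.Injective fun j => ((2 * Real.cos (φ j) : ℝ) : ℂ) := by
    intro i j h
    have h1 : 2 * Real.cos (φ i) = 2 * Real.cos (φ j) := Complex.ofReal_injective h
    have := eq_of_cos_mul_pi_div_eq (by omega) (by omega) (by omega) (by omega)
      (mul_left_cancel₀ two_ne_zero h1)
    exact Fin.ext (by omega)
  have hyli : LinearIndependent ℂ y := by
    refine Module.End.eigenvectors_linearIndependent' (Matrix.toLin' H) _ hcinj y fun j => ?_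
    refine ⟨Module.End.mem_eigenspace_iff.2 (by rw [toLin'_apply, hHy]), ?_⟩
    have hm := mul_pi_div_mem_Ioo (n := n) (j := j + k) (by omega) (by omega)
    exact sineVec_ne_zero (by omega) hu0 (Real.sin_pos_of_pos_of_lt_pi hm.1 hm.2).ne'
  have horth : ∀ i j, i ≠ j → star (y i) ⬝ᵥ y j = 0 := by
    intro i j hij
    have h1 := star_dotProduct_conjTranspose_mulVec H (y i) (y j)
    rw [hHH, hHy, hHy, dotProduct_smul, dotProduct_smul, star_smul, ← star_dotProduct_star,
      star_star] at h1
    have hs : star ((2 * Real.cos (φ i) : ℝ) : ℂ) = ((2 * Real.cos (φ i) : ℝ) : ℂ) :=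
      Complex.conj_ofReal _
    rw [hs, smul_eq_mul, smul_eq_mul] at h1
    by_contra h0
    exact hij (hcinj (mul_right_cancel₀ h0 h1)).symm
  obtain ⟨x, hx0, hxP, hxy⟩ : ∃ x : Fin n → ℂ, x ≠ 0 ∧ x ∈ LinearMap.range P.mulVecLin ∧
      x ∈ Submodule.span ℂ (Set.range y) := by
    have h1 := Submodule.finrank_sup_add_finrank_inf_eq (LinearMap.range P.mulVecLin)
      (Submodule.span ℂ (Set.range y))
    have h2 : Module.finrank ℂ (LinearMap.range P.mulVecLin) = k := hrank
    have h3 := finrank_span_eq_card hyli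
    have h4 := Submodule.finrank_le
      (LinearMap.range P.mulVecLin ⊔ Submodule.span ℂ (Set.range y))
    rw [Module.finrank_fin_fun] at h4
    rw [Fintype.card_fin] at h3
    -- The dimensions k and n+1-k add up to n+1 > n.
    have h5 : LinearMap.range P.mulVecLin ⊓ Submodule.span ℂ (Set.range y) ≠ ⊥ := by
      intro h
      rw [h, finrank_bot] at h1
      omega
    obtain ⟨x, hx, hx0⟩ := Submodule.exists_mem_ne_zero_of_ne_bot h5
    exact ⟨x, hx0, hx.1, hx.2⟩
  have hPx : P *ᵥ x = x := by
    obtain ⟨w, rfl⟩ := hxP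
    rw [mulVecLin_apply, mulVec_mulVec, hP1]
  have hSx : star x ⬝ᵥ (S *ᵥ x) = z * (star x ⬝ᵥ x) := by
    have h1 : star x ⬝ᵥ ((P * S * P) *ᵥ x) = star x ⬝ᵥ (S *ᵥ x) := by
      rw [← mulVec_mulVec, hPx, ← mulVec_mulVec, dotProduct_mulVec, ← hP2, ← star_mulVec, hPx]
    rw [← h1, hP, smul_mulVec, hPx, dotProduct_smul, smul_eq_mul]
  have hreal : star (star x ⬝ᵥ x) = star x ⬝ᵥ x := by
    rw [← star_dotProduct_star, star_star, dotProduct_comm]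
  have hHx : star x ⬝ᵥ (H *ᵥ x) = ((2 * ‖z‖ : ℝ) : ℂ) * (star x ⬝ᵥ x) := by
    have hr : star (‖z‖ : ℂ) = ‖z‖ := Complex.conj_ofReal _
    have hzs : star z = u * ‖z‖ := by
      nth_rewrite 1 [hzu]
      rw [star_mul', star_star, hr]
    rw [hH, add_mulVec, smul_mulVec, smul_mulVec, dotProduct_add, dotProduct_smul,
      dotProduct_smul, star_dotProduct_conjTranspose_mulVec, hSx, star_mul', hreal, hzs,
      smul_eq_mul, smul_eq_mul]
    nth_rewrite 2 [hzu]
    push_cast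
    linear_combination (2 * ‖z‖ * (star x ⬝ᵥ x)) * hu
  obtain ⟨a, rfl⟩ := (Submodule.mem_span_range_iff_exists_fun ℂ).1 hxy
  set N : Fin (n + 1 - k) → ℝ := fun j => Complex.normSq (a j) * ∑ i, Complex.normSq (y j i)
  have hN0 : ∀ j, 0 ≤ N j := fun j =>
    mul_nonneg (Complex.normSq_nonneg _) (Finset.sum_nonneg fun i _ => Complex.normSq_nonneg _)
  have hyy : ∀ j, star (y j) ⬝ᵥ y j = ((∑ i, Complex.normSq (y j i) : ℝ) : ℂ) := fun j => by
    rw [dotProduct, Complex.ofReal_sum]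
    exact Finset.sum_congr rfl fun i _ => Complex.normSq_eq_conj_mul_self.symm
  -- Taking b = 1 gives x*x, and b = 2cos φ gives x*Hx.
  have hsum : ∀ b : Fin (n + 1 - k) → ℝ,
      star (∑ j, a j • y j) ⬝ᵥ (∑ j, a j • ((b j : ℝ) : ℂ) • y j)
        = ((∑ j, b j * N j : ℝ) : ℂ) := by
    intro b
    rw [star_sum, sum_dotProduct, Complex.ofReal_sum]
    refine Finset.sum_congr rfl fun i _ => ?_
    rw [dotProduct_sum, Finset.sum_eq_single i]
    · rw [star_smul, smul_dotProduct, dotProduct_smul, dotProduct_smul, hyy]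
      simp only [smul_eq_mul, N, Complex.ofReal_mul, Complex.normSq_eq_conj_mul_self,
        Complex.star_def]
      ring
    · intro j _ hj
      rw [star_smul, smul_dotProduct, dotProduct_smul, dotProduct_smul, horth i j hj.symm]
      simp
    · simp
  have hxx := hsum fun _ => 1
  simp only [Complex.ofReal_one, one_smul, one_mul] at hxx
  have hHx2 : H *ᵥ (∑ j, a j • y j)
      = ∑ j, a j • ((2 * Real.cos (φ j) : ℝ) : ℂ) • y j := by
    rw [mulVec_sum]
    exact Finset.sum_congr rfl fun j _ => by rw [mulVec_smul, hHy]
  rw [hHx2, hsum fun j => 2 * Real.cos (φ j), hxx] at hHx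
  have hfin : ∑ j, 2 * Real.cos (φ j) * N j = 2 * ‖z‖ * ∑ j, N j := by exact_mod_cast hHx
  have hpos : 0 < ∑ j, N j := by
    refine lt_of_le_of_ne (Finset.sum_nonneg fun j _ => hN0 j) fun h => hx0 ?_
    rw [← h, Complex.ofReal_zero] at hxx
    exact dotProduct_star_self_eq_zero.1 hxx
  have hle : ∑ j, 2 * Real.cos (φ j) * N j
      ≤ 2 * Real.cos (k * Real.pi / (n + 1)) * ∑ j, N j := by
    rw [Finset.mul_sum]
    refine Finset.sum_le_sum fun j _ => mul_le_mul_of_nonneg_right ?_ (hN0 j)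
    have : Real.cos (φ j) ≤ _ := cos_mul_pi_div_le (n := n) (Nat.le_add_left k j) (by omega)
    linarith
  rw [hfin] at hle
  have := le_of_mul_le_mul_right hle hpos
  linarith

theorem theorem2p1 (n k : ℕ) (hn : 2 ≤ n) (hk : 1 ≤ k) (hkn : k ≤ n) :
    (k ≤ (n + 1) / 2 →
      higherRankNumericalRange k (shiftMatrix n) =
        {z : ℂ | ‖z‖ ≤ Real.cos ((k : ℝ) * Real.pi / ((n : ℝ) + 1))}) ∧
    ((n + 1) / 2 < k → higherRankNumericalRange k (shiftMatrix n) = ∅) := by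
  refine ⟨fun h => Set.Subset.antisymm
    (fun z hz => norm_le_of_mem_higherRankNumericalRange_shiftMatrix hk hkn hz)
    fun z hz => ?_, fun h => ?_⟩
  · by_cases hz0 : z = 0
    · exact hz0 ▸ zero_mem_higherRankNumericalRange_shiftMatrix h
    · exact mem_higherRankNumericalRange_shiftMatrix hk hkn hz0 hz
  · refine Set.eq_empty_iff_forall_notMem.2 fun z hz => ?_
    have h1 := norm_le_of_mem_higherRankNumericalRange_shiftMatrix hk hkn hz
    have h2 : Real.cos ((k : ℝ) * Real.pi / (n + 1)) < 0 := by
      have hpi := Real.pi_pos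
      have hm := mul_pi_div_mem_Ioo hk hkn
      refine Real.cos_neg_of_pi_div_two_lt_of_lt ?_ (by linarith [hm.2])
      have : (n + 1 : ℝ) < 2 * k := by
        have : n + 1 < 2 * k := by omega
        exact_mod_cast this
      rw [lt_div_iff₀ (by positivity)]
      nlinarith
    linarith [norm_nonneg z]
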